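/- Let $G=(V,E)$ be a finite connected simple bipartite graph, with a fixed proper black/white colouring of its vertices, embedded in a connected compact orientable surface without boundary so that every face (connected component of the complement) is homeomorphic to a disk and has degree $4$; let $F$ be the set of faces. For each $f\in F$ name the vertices of its boundary, in clockwise order, $x,u,y,v$, with $x,y$ black and $u,v$ white. **Loop model.** A local configuration at $f$ consists of two strands which join the four sides of $f$ in pairs, each strand being red or blue. There are ten of them, in five kinds: - kind 1: one strand around $u$ (joining the sides $xu$ and $uy$) and one around $v$, of the same colour; - kind 2: one strand around $x$ and one around $y$, of the same colour; - kind 3: as kind 1, but with strands of different colours; - kind 4: as kind 2, but with strands of different colours; - kind 5: opposite sides are joined, and the two (crossing) strands have different colours. A $C_2^{(1)}$ loop configuration $\sigma$ is the choice of a local configuration at every face such that the two strands ending at the two sides of each edge of $G$ have the same colour. The strands then form $N_\sigma$ closed loops. Given weights $W=(w_i^f)_{f\in F,\,1\le i\le 5}$ with all $w_i^f>0$, put $$\mathcal Z_{\rm loop}^G(W)=\sum_\sigma 2^{N_\sigma}\prod_{f\in F} w^f_{i(\sigma,f)},$$ where $i(\sigma,f)$ is the kind of $\sigma$ at $f$.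 **Dimer model.** The graph $G^Q$ is obtained from the dual graph $G^*$ by expanding each vertex $f$ of $G^*$ (of degree $4$) into a quadrangle, called a city: its vertices are the sides of the faces of $G$; a road joins the two sides of each edge of $G$; and a city edge joins any two consecutive sides of a face (parallel edges are kept distinct). A dimer configuration is a set $m$ of edges of $G^Q$ such that each vertex of $G^Q$ belongs to exactly one edge of $m$, and for edge weights $\mu$ put $\mathcal Z_{\rm dim}^G(\mu)=\sum_m\prod_{e\in m}\mu_e$. **Theorem.** Suppose that at every face $f$ the free-fermionic relations hold: $$w_1w_4=w_3w_5,\qquad w_2w_3=w_4w_5,\qquad w_5(w_1+w_2)=w_3w_4 .$$ Then for every $f\in F$ there is a unique triple of positive real numbers $(\lambda_f,a_f,b_f)$ with $a_f^2+b_f^2=1$ and $$(w_1^f,w_2^f,w_3^f,w_4^f,w_5^f)=\lambda_f\,(a_f^2,\;b_f^2,\;a_f,\;b_f,\;a_fb_f).$$ Let $\mu$ be the edge weights on $G^Q$ for which every road has weight $1$ and, in the city of $f$, the edge joining two consecutive sides of $f$ has weight $a_f$ if their common vertex is white and $b_f$ if it is black. Then $$\mathcal Z_{\rm loop}^G(W)=\Big(\prod_{f\in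 F}\lambda_f\Big)\,\big(\mathcal Z_{\rm dim}^G(\mu)\big)^2 .$$ -/

import Mathlib

namespace C21Loops

/-! ### Cellular embeddings in oriented surfaces -/

/-- A cellular embedding of a connected graph `G` in a connected compact oriented surface without
boundary, encoded (Heffter, Edmonds) by its rotation system: the permutation `rot` of the darts
(oriented edges) of `G` sends a dart to the next dart, in counterclockwise order, with the same
initial vertex, so that its cycles are exactly the sets of darts leaving a given vertex.
Up to orientation-preserving homeomorphism, cellular embeddings of `G` (those all of whose faces
are homeomorphic to open disks) are the same thing as rotation systems. -/
structure RotationSystem {V : Type*} (G : SimpleGraph V) where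
  connected : G.Connected
  /-- A graph reduced to one vertex is excluded. Its only face, a disk of degree zero, would not
  be seen by the darts. -/
  nonempty_dart : Nonempty G.Dart
  rot : Equiv.Perm G.Dart
  rot_fst : ∀ d : G.Dart, (rot d).fst = d.fst
  sameCycle_rot : ∀ d d' : G.Dart, d.fst = d'.fst → rot.SameCycle d d'

namespace RotationSystem

variable {V : Type*} {G : SimpleGraph V} (R : RotationSystem G)

/-- The permutation sending a dart to the one that follows it on the boundary of the face lying
on its right: reverse the dart, then turn to the next dart counterclockwise. Hence the boundary
of each face is followed clockwise (the face being seen from its inside). A dart `d` can be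
thought of as one side of the face on its right. The same edge seen from the other face that it
borders is `d.symm`. -/
def facePerm : Equiv.Perm G.Dart where
  toFun d := R.rot d.symm
  invFun d := (R.rot.symm d).symm
  left_inv d := by simp
  right_inv d := by simp

/-- Faces are the cycles of `facePerm`. -/
def Face : Type _ := Quotient (Equiv.Perm.SameCycle.setoid R.facePerm)

/-- The face on the right of a dart. -/
def faceOf (d : G.Dart) : R.Face :=
  Quotient.mk (Equiv.Perm.SameCycle.setoid R.facePerm) d

/-- The degree of a face: the number of its sides, an edge being counted twice when the face lies
on both sides of it. -/
noncomputable def faceDegree (f : R.Face) : ℕ := Nat.card {d : G.Dart // R.faceOf d = f}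

/-- All faces have degree four. -/
def IsQuadrangulation : Prop := ∀ f : R.Face, R.faceDegree f = 4

instance dart_finite [Finite V] : Finite G.Dart :=
  Finite.of_injective (fun d : G.Dart => d.toProd) (fun _ _ h => SimpleGraph.Dart.ext _ _ h)

instance face_finite [Finite V] : Finite R.Face :=
  Finite.of_surjective R.faceOf Quotient.mk_surjective

noncomputable instance face_fintype [Finite V] : Fintype R.Face := Fintype.ofFinite _

end RotationSystem

/-- A choice, for every face `f` of a bipartite quadrangulation (the vertices `v` with
`black v = true` being black), of the names of the vertices `x, u, y, v` of `f`, in clockwise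
order, with `x, y` black and `u, v` white. It amounts to the choice of the first side `x → u`. -/
structure FaceNames {V : Type*} {G : SimpleGraph V} (R : RotationSystem G)
    (black : G.Coloring Bool) where
  first : R.Face → G.Dart
  faceOf_first : ∀ f, R.faceOf (first f) = f
  black_first : ∀ f, black (first f).fst = true

namespace FaceNames

variable {V : Type*} {G : SimpleGraph V} {R : RotationSystem G} {black : G.Coloring Bool}

/-- The four sides of a face: side `0` is `x → u`, side `1` is `u → y`, side `2` is `y → v`,
side `3` is `v → x`. With `x, u, y, v` drawn on the left, top, right, bottom respectively, these
are the upper left, upper right, lower right, lower left sides. -/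
def side (N : FaceNames R black) (f : R.Face) (j : Fin 4) : G.Dart :=
  (R.facePerm ^ (j : ℕ)) (N.first f)

end FaceNames

/-! ### The loop model -/

inductive Color
  | red
  | blue
  deriving DecidableEq

/-- The five kinds of local configurations, which carry the weights. -/
inductive Kind
  | one
  | two
  | three
  | four
  | five
  deriving DecidableEq

/-- The two colorings of each kind of local configuration. -/
inductive Variant
  | a
  | b
  deriving DecidableEq

instance : Fintype Kind where
  elems := {.one, .two, .three, .four, .five}
  complete i := by cases i <;> decide

instance : Fintype Variant where
  elems := {.a, .b}
  complete k := by cases k <;> decide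

/-- How the strands of a local configuration join the four sides of a face.
Kinds one and three have one strand around `u` (joining the sides `x u` and `u y`) and one
around `v`. Kinds two and four have one strand around `x` and one around `y`. In kind five
opposite sides are joined and the two strands cross. -/
def Kind.joined : Kind → Fin 4 → Fin 4
  | .one => ![1, 0, 3, 2]
  | .two => ![3, 2, 1, 0]
  | .three => ![1, 0, 3, 2]
  | .four => ![3, 2, 1, 0]
  | .five => ![2, 3, 0, 1]

/-- The color of the strand that reaches a given side, in each of the ten local configurations. -/
def localColor : Kind → Variant → Fin 4 → Color
  | .one, .a => ![.red, .red, .red, .red]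
  | .one, .b => ![.blue, .blue, .blue, .blue]
  | .two, .a => ![.red, .red, .red, .red]
  | .two, .b => ![.blue, .blue, .blue, .blue]
  | .three, .a => ![.red, .red, .blue, .blue]
  | .three, .b => ![.blue, .blue, .red, .red]
  | .four, .a => ![.red, .blue, .blue, .red]
  | .four, .b => ![.blue, .red, .red, .blue]
  | .five, .a => ![.red, .blue, .red, .blue]
  | .five, .b => ![.blue, .red, .blue, .red]

section Loops

variable {V : Type*} {G : SimpleGraph V} {R : RotationSystem G} {black : G.Coloring Bool}

/-- A loop configuration: a local configuration at every face, such that two sides of faces that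
are glued together (they are the two sides of one edge) have the same color. -/
structure LoopConfig (N : FaceNames R black) where
  kind : R.Face → Kind
  variant : R.Face → Variant
  glued : ∀ (f f' : R.Face) (j j' : Fin 4), (N.side f j).symm = N.side f' j' →
    localColor (kind f) (variant f) j = localColor (kind f') (variant f') j'

namespace LoopConfig

variable {N : FaceNames R black}

instance finite [Finite V] (N : FaceNames R black) : Finite (LoopConfig N) :=
  Finite.of_injective
    (fun s : LoopConfig N => ((s.kind, s.variant) : (R.Face → Kind) × (R.Face → Variant)))
    (fun s t h => by
      cases s
      cases t
      simp only [Prod.mk.injEq] at h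
      obtain ⟨rfl, rfl⟩ := h
      rfl)

noncomputable instance fintype [Finite V] (N : FaceNames R black) : Fintype (LoopConfig N) :=
  Fintype.ofFinite _

/-- One step along a loop: a side of a face is followed either by the other side of the same
edge (crossing the edge), or by the side of the same face at the other end of the strand. -/
inductive Step (s : LoopConfig N) : G.Dart → G.Dart → Prop
  | cross (d : G.Dart) : Step s d d.symm
  | strand (f : R.Face) (j : Fin 4) : Step s (N.side f j) (N.side f ((s.kind f).joined j))

/-- The loops of a configuration: the classes of sides of faces connected by strands. Every edge
is crossed by exactly one loop. -/
def Loop (s : LoopConfig N) : Type _ := Quotient (Relation.EqvGen.setoid s.Step)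

/-- The number of loops. -/
noncomputable def numLoops (s : LoopConfig N) : ℕ := Nat.card s.Loop

end LoopConfig

/-- Weight of a loop configuration with fugacity `2`. The local weights do not depend on the
variant. -/
noncomputable def loopWeight [Finite V] {N : FaceNames R black} (W : R.Face → Kind → ℝ)
    (s : LoopConfig N) : ℝ :=
  2 ^ s.numLoops * ∏ f : R.Face, W f (s.kind f)

/-- Partition function of the loop model. -/
noncomputable def loopPartition [Finite V] (N : FaceNames R black) (W : R.Face → Kind → ℝ) : ℝ :=
  ∑ s : LoopConfig N, loopWeight W s

end Loops

/-! ### Dimers -/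

section Dimers

variable {α β : Type*}

/-- Dimer configurations of a multigraph: sets of edges such that every vertex belongs to exactly
one of them. -/
def IsDimerConfig (H : Graph α β) (m : Finset β) : Prop :=
  (∀ e ∈ m, e ∈ H.edgeSet) ∧ ∀ v ∈ H.vertexSet, ∃! e, e ∈ m ∧ H.Inc e v

noncomputable instance dimerConfig_fintype [Finite β] (H : Graph α β) :
    Fintype {m : Finset β // IsDimerConfig H m} :=
  Fintype.ofFinite _

/-- Partition function of the dimer model on a multigraph with edge weights `μ`. -/
noncomputable def dimerPartition [Finite β] (H : Graph α β) (μ : β → ℝ) : ℝ :=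
  ∑ m : {m : Finset β // IsDimerConfig H m}, ∏ e ∈ m.1, μ e

end Dimers

section Decorated

variable {V : Type*} {G : SimpleGraph V}

/-- The graph `G^Q`, obtained from the dual graph by expanding each vertex (each face of `G`) into
a quadrangle, its city. Its vertices are the sides of the faces of `G`, that is the darts of `G`.
It has one road for each edge of `G`, joining the two sides of that edge, and one city edge for
each dart `d`, joining the side `d` to the next side of the same face. -/
def decoratedGraph (R : RotationSystem G) : Graph G.Dart (G.edgeSet ⊕ G.Dart) where
  vertexSet := Set.univ
  IsLink
    | .inl e, p, q => p.edge = e.1 ∧ q = p.symm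
    | .inr d, p, q => (p = d ∧ q = R.facePerm d) ∨ (q = d ∧ p = R.facePerm d)
  isLink_symm := by
    rintro (e | d) -
    · refine ⟨fun p q h => ?_⟩
      obtain ⟨h1, rfl⟩ := h
      exact ⟨by simpa using h1, by simp⟩
    · exact ⟨fun p q h => h.symm⟩
  eq_or_eq_of_isLink_of_isLink := by
    rintro (e | d) x y v w h h'
    · obtain ⟨h1, rfl⟩ := h
      obtain ⟨h2, rfl⟩ := h'
      exact (SimpleGraph.dart_edge_eq_iff _ _).1 (h1.trans h2.symm)
    · rcases h with ⟨rfl, rfl⟩ | ⟨rfl, rfl⟩ <;> rcases h' with ⟨rfl, rfl⟩ | ⟨h1, h2⟩ <;>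
        simp_all
  left_mem_of_isLink := fun _ _ _ _ => Set.mem_univ _

/-- The weights: roads have weight `1`. The city edge between the consecutive sides `d` and
`facePerm d` of a face `f` is in front of their common vertex `d.snd`. Its weight is `a f` if this
vertex is white and `b f` if it is black. -/
def decoratedWeight (R : RotationSystem G) (black : G.Coloring Bool) (a b : R.Face → ℝ) :
    G.edgeSet ⊕ G.Dart → ℝ
  | .inl _ => 1
  | .inr d => if black d.snd = true then b (R.faceOf d) else a (R.faceOf d)

end Decorated

/-! ### Free-fermionic weights -/

/-- The free-fermionic relations. -/
def FreeFermionic (w : Kind → ℝ) : Prop :=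
  w .one * w .four = w .three * w .five ∧
  w .two * w .three = w .four * w .five ∧
  w .five * (w .one + w .two) = w .three * w .four

/-- The triple `(lam, a, b)` of positive numbers, with `a ^ 2 + b ^ 2 = 1`, represents the local
weights `w`. -/
def Represents (w : Kind → ℝ) (lam a b : ℝ) : Prop :=
  0 < lam ∧ 0 < a ∧ 0 < b ∧ a ^ 2 + b ^ 2 = 1 ∧
  w .one = lam * a ^ 2 ∧ w .two = lam * b ^ 2 ∧ w .three = lam * a ∧ w .four = lam * b ∧
  w .five = lam * (a * b)

end C21Loops

open C21Loops

namespace C21Loops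

/-! ### Representation of free-fermionic weights -/

/-! The factor `2 ^ N` counts orientations of the loops. Each loop alternates between crossing an
edge and following a strand, so it has exactly two orientations (`exists_alternating`). Record an
orientation by the function `s` of the edges telling on which side of the loop the black end of the
edge lies. A strand turning around a vertex keeps that vertex on one side, so `s` is unchanged along
it; a crossing strand passes between vertices of opposite colors, so `s` changes. Orientations thus
become a local constraint on `s` (`loopsEquiv`), and the loop model becomes a sum, over a coloring
`c` and a function `s` of the edges, of a product of face weights (`loopPartition_eq_sum`).

The dimer model is likewise a sum over the set `s` of occupied roads, with a product over cities
(`dimerPartition_eq_sum`). For weights `(a ^ 2, b ^ 2, a, b, a * b)` up to the factor `lam`, the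
loop weight of a face at `(c, s)` is `lam` times the product of the city weights at `s` and at `s
xor c` (`localLoopSum_eq_mul`). The substitution of `s xor c` for `c` then decouples the double sum
into a square. The free-fermionic relations serve only to produce the parametrization. -/

theorem existsUnique_represents {w : Kind → ℝ} (hw : ∀ i, 0 < w i) (hff : FreeFermionic w) :
    ∃! p : ℝ × ℝ × ℝ, Represents w p.1 p.2.1 p.2.2 := by
  obtain ⟨h1, h2, h3⟩ := hff
  have p1 := hw .one
  have p2 := hw .two
  have p3 := hw .three
  have p4 := hw .four
  have p5 := hw .five
  set L := w .one + w .two with hL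
  have hLpos : 0 < L := by positivity
  -- Times `w .four`, this is `w₃ (w₃ w₄) = w₃ w₅ L = w₁ w₄ L`, by the third and then the first
  -- relation; `e2` is symmetric.
  have e1 : w .three ^ 2 = w .one * L := by
    apply mul_right_cancel₀ p4.ne'
    linear_combination -w .three * h3 - L * h1
  have e2 : w .four ^ 2 = w .two * L := by
    apply mul_right_cancel₀ p3.ne'
    linear_combination -w .four * h3 - L * h2
  refine ⟨(L, w .three / L, w .four / L), ?_, ?_⟩
  · refine ⟨hLpos, by positivity, by positivity, ?_, ?_, ?_, ?_, ?_, ?_⟩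
    · field_simp
      linear_combination e1 + e2 + L * hL
    · field_simp
      linear_combination -e1
    · field_simp
      linear_combination -e2
    · field_simp
    · field_simp
    · field_simp
      linear_combination h3
  · rintro ⟨l, a, b⟩ ⟨hl, -, -, hab, q1, q2, q3, q4, -⟩
    simp only at hl hab q1 q2 q3 q4
    -- The normalization forces the scale: `w₁ + w₂ = l (a ^ 2 + b ^ 2) = l`.
    have hlL : l = L := by linear_combination -q1 - q2 - l * hab
    subst hlL
    ext <;> simp only
    · rw [q3]; field_simp
    · rw [q4]; field_simp

/-! ### Two involutions without fixed points -/

/-- Two fixed-point-free involutions on a type can be flipped simultaneously by a `Bool`-valued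
function: the graph formed by two perfect matchings is bipartite. -/
theorem exists_alternating {X : Type*} (α β : X → X) (hα : Function.Involutive α)
    (hβ : Function.Involutive β) (hα' : ∀ x, α x ≠ x) (hβ' : ∀ x, β x ≠ x) :
    ∃ o : X → Bool, (∀ x, o (α x) = !o x) ∧ ∀ x, o (β x) = !o x := by
  classical
  let A : Equiv.Perm X := hα.toPerm α
  let B : Equiv.Perm X := hβ.toPerm β
  have hA : ∀ x, A x = α x := fun _ => rfl
  have hB : ∀ x, B x = β x := fun _ => rfl
  have hAA : A * A = 1 := Equiv.ext hα
  have hBB : B * B = 1 := Equiv.ext hβ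
  have hAi : A⁻¹ = A := inv_eq_of_mul_eq_one_left hAA
  have hBi : B⁻¹ = B := inv_eq_of_mul_eq_one_left hBB
  let π : Equiv.Perm X := A * B
  have conj : ∀ k : ℤ, A * π ^ k = π ^ (-k) * A := by
    intro k
    have h : A * π * A⁻¹ = π⁻¹ := by
      simp only [π, mul_inv_rev, hAi, hBi, ← mul_assoc, hAA, one_mul]
    rw [zpow_neg, ← inv_zpow, ← h, conj_zpow, inv_mul_cancel_right]
  -- If `π ^ k` sends `x` to `α x`, then `A * π ^ k` fixes `x`. But it is a reflection of the
  -- dihedral action: conjugate to `A` for `k` even, to `B` for `k` odd, and neither has a fixed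
  -- point.
  have key : ∀ x, ¬π.SameCycle x (α x) := by
    rintro x ⟨k, hk⟩
    have hfix : (A * π ^ k) x = x := by
      rw [Equiv.Perm.mul_apply, hk]
      exact hα x
    obtain ⟨m, rfl | rfl⟩ := Int.even_or_odd' k
    · have e : A * π ^ (2 * m) = π ^ (-m) * A * π ^ m := by
        rw [two_mul, zpow_add, ← mul_assoc, conj]
      rw [e, mul_assoc, Equiv.Perm.mul_apply, zpow_neg, Equiv.Perm.inv_eq_iff_eq,
        Equiv.Perm.mul_apply] at hfix
      exact hα' _ hfix
    · have e : A * π ^ (2 * m + 1) = π ^ (-m) * B * π ^ m := by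
        have : B = A * π := by simp only [π, ← mul_assoc, hAA, one_mul]
        rw [this, ← mul_assoc, ← conj, mul_assoc, mul_assoc, ← zpow_one_add, ← zpow_add]
        congr 2
        ring
      rw [e, mul_assoc, Equiv.Perm.mul_apply, zpow_neg, Equiv.Perm.inv_eq_iff_eq,
        Equiv.Perm.mul_apply] at hfix
      exact hβ' _ hfix
  have hsame : ∀ {x y}, π.SameCycle x y → π.SameCycle (α x) (α y) := by
    rintro x y ⟨k, rfl⟩
    refine ⟨-k, ?_⟩
    have := congrArg (fun g : Equiv.Perm X => g x) (conj k)
    exact this.symm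
  -- An orbit under both involutions is the union of two cycles of `π`, distinct by `key` and
  -- exchanged by `α`. The sought function singles out the cycle containing a chosen representative
  -- of the orbit.
  let S : Setoid X :=
    { r := fun x y => π.SameCycle x y ∨ π.SameCycle (α x) y
      iseqv := by
        refine ⟨fun x => .inl (.refl _ _), ?_, ?_⟩
        · rintro x y (h | h)
          · exact .inl h.symm
          · refine .inr ?_
            have := hsame h
            rw [hα] at this
            exact this.symm
        · rintro x y z (h | h) (h' | h')
          · exact .inl (h.trans h')
          · exact .inr ((hsame h).trans h')
          · exact .inr (h.trans h')
          · have := hsame h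
            rw [hα] at this
            exact .inl (this.trans h') }
  let r : X → X := fun x => (Quotient.mk S x).out
  have hr : ∀ x, π.SameCycle (r x) x ∨ π.SameCycle (α (r x)) x := fun x =>
    Quotient.mk_out (s := S) x
  have rcongr : ∀ x y, S.r x y → r x = r y := fun x y h => by
    simp only [r]
    rw [Quotient.sound (s := S) h]
  have h1 : ∀ x, decide (π.SameCycle (r (α x)) (α x)) = !decide (π.SameCycle (r x) x) := by
    intro x
    rw [← rcongr x (α x) (.inr (.refl _ _)), ← decide_not, decide_eq_decide]
    constructor
    · intro h h'
      exact key x (h'.symm.trans h)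
    · intro h
      have := hsame ((hr x).resolve_left h)
      rwa [hα] at this
  refine ⟨fun x => decide (π.SameCycle (r x) x), h1, fun x => ?_⟩
  have e : β x = α (π x) := (hα (β x)).symm
  have hx : π.SameCycle x (π x) := ⟨1, rfl⟩
  simp only
  rw [e, h1, ← rcongr x (π x) (.inl hx)]
  congr 1
  rw [decide_eq_decide, Equiv.Perm.sameCycle_apply_right]

/-! ### The sides of the faces of a quadrangulation -/

section Sides

variable {V : Type*} {G : SimpleGraph V} {R : RotationSystem G} {black : G.Coloring Bool}

theorem RotationSystem.faceOf_eq_iff {d d' : G.Dart} :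
    R.faceOf d = R.faceOf d' ↔ R.facePerm.SameCycle d d' :=
  Quotient.eq (r := Equiv.Perm.SameCycle.setoid R.facePerm)

theorem RotationSystem.facePerm_fst (d : G.Dart) : (R.facePerm d).fst = d.snd :=
  R.rot_fst d.symm

theorem Coloring.black_snd (black : G.Coloring Bool) (d : G.Dart) :
    black d.snd = !black d.fst :=
  Bool.eq_not_of_ne (black.valid d.adj).symm

namespace FaceNames

theorem faceOf_side (N : FaceNames R black) (f : R.Face) (j : Fin 4) :
    R.faceOf (N.side f j) = f := by
  rw [← N.faceOf_first f, RotationSystem.faceOf_eq_iff, side, N.faceOf_first]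
  exact Equiv.Perm.sameCycle_pow_left.2 (.refl _ _)

theorem isCycleOn_face [Finite V] (R : RotationSystem G) (f : R.Face) :
    R.facePerm.IsCycleOn {d | R.faceOf d = f} := by
  refine ⟨R.facePerm.bijOn fun d => ?_, ?_⟩
  · simp only [Set.mem_ofPred_eq]
    rw [RotationSystem.faceOf_eq_iff.2 (Equiv.Perm.sameCycle_apply_left.2 (.refl _ d))]
  · rintro d rfl d' hd'
    exact RotationSystem.faceOf_eq_iff.1 hd'.symm

/-- On the sides of a face, `facePerm` acts as a single cycle, whose length is the degree of the
face. -/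
theorem pow_first_eq_iff [Finite V] (N : FaceNames R black) (hR : R.IsQuadrangulation)
    (f : R.Face) (m n : ℕ) :
    (R.facePerm ^ m) (N.first f) = (R.facePerm ^ n) (N.first f) ↔ m ≡ n [MOD 4] := by
  classical
  have : Fintype G.Dart := Fintype.ofFinite _
  have h : R.facePerm.IsCycleOn (Finset.univ.filter fun d => R.faceOf d = f : Finset G.Dart) := by
    simpa using isCycleOn_face R f
  have hc : (Finset.univ.filter fun d => R.faceOf d = f).card = 4 := by
    rw [← hR f, RotationSystem.faceDegree, Nat.card_eq_fintype_card, Fintype.card_subtype]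
  rw [h.pow_apply_eq_pow_apply (by simp [N.faceOf_first]), hc]

theorem facePerm_side [Finite V] (N : FaceNames R black) (hR : R.IsQuadrangulation)
    (f : R.Face) (j : Fin 4) : R.facePerm (N.side f j) = N.side f (j + 1) := by
  rw [side, side, ← Equiv.Perm.mul_apply, ← pow_succ', N.pow_first_eq_iff hR]
  revert j
  decide

theorem side_bijective [Finite V] (N : FaceNames R black) (hR : R.IsQuadrangulation) :
    Function.Bijective fun p : R.Face × Fin 4 => N.side p.1 p.2 := by
  constructor
  · rintro ⟨f, i⟩ ⟨g, j⟩ h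
    simp only at h
    obtain rfl : f = g := by rw [← N.faceOf_side f i, h, N.faceOf_side]
    rw [side, side, N.pow_first_eq_iff hR] at h
    congr 1
    revert i j
    decide
  · intro d
    have h := (isCycleOn_face R (R.faceOf d)).2 (N.faceOf_first _) (rfl : R.faceOf d = _)
    obtain ⟨n, hn⟩ := h.exists_nat_pow_eq
    refine ⟨(R.faceOf d, Fin.ofNat 4 n), Eq.trans ?_ hn⟩
    simp only [side]
    rw [N.pow_first_eq_iff hR]
    simp [Nat.ModEq]

/-- The sides of the faces, numbered, are the darts. -/
noncomputable def sideEquiv [Finite V] (N : FaceNames R black) (hR : R.IsQuadrangulation) :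
    R.Face × Fin 4 ≃ G.Dart :=
  Equiv.ofBijective _ (N.side_bijective hR)

theorem sideEquiv_apply [Finite V] (N : FaceNames R black) (hR : R.IsQuadrangulation)
    (p : R.Face × Fin 4) : N.sideEquiv hR p = N.side p.1 p.2 := rfl

theorem forall_side [Finite V] (N : FaceNames R black) (hR : R.IsQuadrangulation)
    {P : G.Dart → Prop} : (∀ d, P d) ↔ ∀ f j, P (N.side f j) := by
  rw [← (N.sideEquiv hR).forall_congr_right, Prod.forall]
  rfl

/-- Whether the initial vertex of a side is black. -/
def startsBlack : Fin 4 → Bool := ![true, false, true, false]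

theorem black_side_fst [Finite V] (N : FaceNames R black) (hR : R.IsQuadrangulation)
    (f : R.Face) (j : Fin 4) : black (N.side f j).fst = startsBlack j := by
  have h0 : black (N.side f 0).fst = true := N.black_first f
  have hs : ∀ i, black (N.side f (i + 1)).fst = !black (N.side f i).fst := fun i => by
    rw [← N.facePerm_side hR, RotationSystem.facePerm_fst, Coloring.black_snd]
  have h1 := hs 0
  have h2 := hs 1
  have h3 := hs 2
  simp only [Fin.reduceAdd, h0] at h1 h2 h3
  fin_cases j <;> simp_all [startsBlack]

end FaceNames

end Sides

/-! ### Functions of the edges -/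

section EdgeFunctions

variable {V : Type*} {G : SimpleGraph V}

/-- A `Bool`-valued function of the edges of `G`, seen as a function of the darts. -/
abbrev EdgeFun (G : SimpleGraph V) : Type _ := {s : G.Dart → Bool // ∀ d, s d.symm = s d}

noncomputable instance edgeFun_fintype [Finite V] : Fintype (EdgeFun G) := Fintype.ofFinite _

/-- Adding a fixed function of the edges modulo two. -/
def EdgeFun.xorEquiv (s : EdgeFun G) : EdgeFun G ≃ EdgeFun G where
  toFun c := ⟨fun d => s.1 d ^^ c.1 d, fun d => by simp only [s.2, c.2]⟩
  invFun c := ⟨fun d => s.1 d ^^ c.1 d, fun d => by simp only [s.2, c.2]⟩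
  left_inv c := by ext d; simp
  right_inv c := by ext d; simp

end EdgeFunctions

/-! ### Orientations of the loops -/

section Orientations

variable {V : Type*} {G : SimpleGraph V} {R : RotationSystem G} {black : G.Coloring Bool}
  {N : FaceNames R black}

/-- Whether the strands of a local configuration cross the face. -/
def Kind.crosses : Kind → Bool
  | .five => true
  | _ => false

theorem Kind.joined_joined (k : Kind) (j : Fin 4) : k.joined (k.joined j) = j := by
  revert k j
  decide

theorem Kind.joined_ne (k : Kind) (j : Fin 4) : k.joined j ≠ j := by
  revert k j
  decide

/-- Vertex colors alternate around a face: a strand around a vertex joins sides of opposite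
parities, a crossing strand sides of equal parity. -/
theorem Kind.startsBlack_joined (k : Kind) (j : Fin 4) :
    FaceNames.startsBlack (k.joined j) = !(k.crosses ^^ FaceNames.startsBlack j) := by
  revert k j
  decide

theorem xor_turn : ∀ c x y z : Bool, (x ^^ ((!y) ^^ !(c ^^ z))) = (c ^^ (x ^^ (y ^^ z))) := by
  decide

theorem xor_turn' : ∀ c x y z : Bool, ((c ^^ x) ^^ ((!y) ^^ !(c ^^ z))) = (x ^^ (y ^^ z)) := by
  decide

namespace LoopConfig

/-- A function of the edges is compatible with a loop configuration if it changes along the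
crossing strands and only along them. -/
def Compatible (σ : LoopConfig N) (s : EdgeFun G) : Prop :=
  ∀ f j, s.1 (N.side f ((σ.kind f).joined j)) = ((σ.kind f).crosses ^^ s.1 (N.side f j))

/-- The loops can be oriented: `o d` tells whether the loop through the side `d` enters there the
face of `d`. -/
theorem exists_orientation [Finite V] (hR : R.IsQuadrangulation) (σ : LoopConfig N) :
    ∃ o : G.Dart → Bool, ∀ d e, σ.Step d e → o e = !o d := by
  let e := N.sideEquiv hR
  obtain ⟨β, hβ⟩ : ∃ β : G.Dart → G.Dart,
      ∀ f j, β (N.side f j) = N.side f ((σ.kind f).joined j) := by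
    refine ⟨fun d => N.side (e.symm d).1 ((σ.kind (e.symm d).1).joined (e.symm d).2), ?_⟩
    intro f j
    have : e.symm (N.side f j) = (f, j) := e.symm_apply_apply (f, j)
    simp only [this]
  have hinv : ∀ d, β (β d) = d := by
    rw [N.forall_side hR]
    intro f j
    rw [hβ, hβ, Kind.joined_joined]
  have hne : ∀ d, β d ≠ d := by
    rw [N.forall_side hR]
    intro f j h
    rw [hβ] at h
    have h' : ((f, (σ.kind f).joined j) : R.Face × Fin 4) = (f, j) := e.injective h
    exact Kind.joined_ne _ _ (Prod.ext_iff.1 h').2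
  obtain ⟨o, h1, h2⟩ := exists_alternating SimpleGraph.Dart.symm β
    SimpleGraph.Dart.symm_involutive hinv SimpleGraph.Dart.symm_ne hne
  refine ⟨o, ?_⟩
  intro d e h
  obtain d | ⟨f, j⟩ := h
  · exact h1 d
  · rw [← hβ, h2]

/-- Orienting the loops amounts to choosing a compatible function of the edges: the one telling
whether the loop crossing an edge has its black end on the left. -/
noncomputable def loopsEquiv [Finite V] (hR : R.IsQuadrangulation) (σ : LoopConfig N) :
    (σ.Loop → Bool) ≃ {s : EdgeFun G // σ.Compatible s} := by
  let o := (σ.exists_orientation hR).choose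
  have ho : ∀ d e, σ.Step d e → o e = !o d := (σ.exists_orientation hR).choose_spec
  have hstep : ∀ d e, σ.Step d e → Quotient.mk (Relation.EqvGen.setoid σ.Step) e =
      Quotient.mk (Relation.EqvGen.setoid σ.Step) d := fun d e h =>
    (Quotient.sound (Relation.EqvGen.rel _ _ h)).symm
  refine
    -- Here `o` is a reference orientation and `g` selects the loops to reverse. Across an edge both
    -- `o` and the color of the initial vertex flip, so their sum descends to edges. Along a strand
    -- `o` flips, and the color flips unless the strand is crossing.
    { toFun := fun g => ⟨⟨fun d => g (Quotient.mk _ d) ^^ (o d ^^ black d.fst), fun d => ?_⟩, ?_⟩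
      invFun := fun s => Quotient.lift (fun d => s.1.1 d ^^ (o d ^^ black d.fst)) ?_
      left_inv := fun g => ?_
      right_inv := fun s => ?_ }
  · have h := Step.cross (s := σ) d
    have hb : black d.symm.fst = !black d.fst := Coloring.black_snd black d
    simp only [ho _ _ h, hstep _ _ h, hb]
    simp
  · intro f j
    have h := Step.strand (s := σ) f j
    simp only [ho _ _ h, hstep _ _ h, N.black_side_fst hR, Kind.startsBlack_joined]
    exact xor_turn _ _ _ _
  · intro d e h
    replace h : Relation.EqvGen σ.Step d e := h
    induction h with
    | rel d e h =>
      rw [ho _ _ h]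
      cases h with
      | cross d =>
        have hb : black d.symm.fst = !black d.fst := Coloring.black_snd black d
        rw [s.1.2, hb]
        simp
      | strand f j =>
        rw [s.2, N.black_side_fst hR, N.black_side_fst hR, Kind.startsBlack_joined]
        exact (xor_turn' _ _ _ _).symm
    | refl => rfl
    | symm _ _ _ ih => exact ih.symm
    | trans _ _ _ _ _ ih ih' => exact ih.trans ih'
  · funext x
    induction x using Quotient.inductionOn
    simp
  · ext d
    simp

theorem two_pow_numLoops [Finite V] (hR : R.IsQuadrangulation) (σ : LoopConfig N) :
    2 ^ σ.numLoops = Nat.card {s : EdgeFun G // σ.Compatible s} := by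
  have : Finite σ.Loop := Finite.of_surjective _ (Quotient.mk_surjective (s :=
    Relation.EqvGen.setoid σ.Step))
  rw [← Nat.card_congr (σ.loopsEquiv hR), Nat.card_fun, numLoops]
  simp

end LoopConfig

end Orientations

/-! ### The loop model as a sum over pairs of functions of the edges -/

section LoopSum

variable {V : Type*} {G : SimpleGraph V} {R : RotationSystem G} {black : G.Coloring Bool}
  {N : FaceNames R black}

/-- The color `c` and the orientation `s` of the sides of a face fit a local configuration. -/
def LocallyFits (c s : Fin 4 → Bool) (p : Kind × Variant) : Prop :=
  (∀ j, c j = decide (localColor p.1 p.2 j = .blue)) ∧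
    ∀ j, s (p.1.joined j) = (p.1.crosses ^^ s j)

instance (c s : Fin 4 → Bool) (p : Kind × Variant) : Decidable (LocallyFits c s p) :=
  inferInstanceAs (Decidable (_ ∧ _))

/-- The sum of the weights of the local configurations that a given coloring and a given
orientation of the sides of a face fit. -/
def localLoopSum (w : Kind → ℝ) (c s : Fin 4 → Bool) : ℝ :=
  ∑ p : Kind × Variant, if LocallyFits c s p then w p.1 else 0

theorem decide_eq_blue_inj {x y : Color} (h : decide (x = .blue) = decide (y = .blue)) :
    x = y := by
  revert h
  cases x <;> cases y <;> decide

namespace LoopConfig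

theorem exists_color [Finite V] (hR : R.IsQuadrangulation) (σ : LoopConfig N) :
    ∃ c : EdgeFun G, ∀ f j, c.1 (N.side f j) =
      decide (localColor (σ.kind f) (σ.variant f) j = .blue) := by
  let e := N.sideEquiv hR
  obtain ⟨c, hc⟩ : ∃ c : G.Dart → Bool, ∀ f j, c (N.side f j) =
      decide (localColor (σ.kind f) (σ.variant f) j = .blue) := by
    refine ⟨fun d => decide (localColor (σ.kind (e.symm d).1) (σ.variant (e.symm d).1)
      (e.symm d).2 = .blue), fun f j => ?_⟩
    have : e.symm (N.side f j) = (f, j) := e.symm_apply_apply (f, j)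
    simp only [this]
  refine ⟨⟨c, ?_⟩, hc⟩
  rw [N.forall_side hR]
  intro f j
  obtain ⟨⟨f', j'⟩, h⟩ := (N.side_bijective hR).2 (N.side f j).symm
  simp only at h
  rw [← h, hc, hc, σ.glued f f' j j' h.symm]

end LoopConfig

theorem EdgeFun.ext_side [Finite V] (hR : R.IsQuadrangulation) (N : FaceNames R black)
    {c c' : EdgeFun G} (h : ∀ f j, c.1 (N.side f j) = c'.1 (N.side f j)) : c = c' :=
  Subtype.ext (funext ((N.forall_side hR).2 h))

/-- The gluing condition says exactly that the local colors come from one function of the edges.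
Summing over that function makes the choices at the faces independent. -/
theorem sum_compatible [Finite V] (hR : R.IsQuadrangulation) (W : R.Face → Kind → ℝ)
    (s : EdgeFun G) [DecidablePred fun σ : LoopConfig N => σ.Compatible s] :
    (∑ σ : LoopConfig N, if σ.Compatible s then ∏ f, W f (σ.kind f) else 0) =
      ∑ c : EdgeFun G, ∏ f : R.Face,
        localLoopSum (W f) (fun j => c.1 (N.side f j)) fun j => s.1 (N.side f j) := by
  classical
  simp only [localLoopSum, Finset.prod_univ_sum, Fintype.piFinset_univ, Finset.prod_ite_zero]
  rw [← Fintype.sum_prod_type']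
  choose col hcol using fun σ : LoopConfig N => σ.exists_color hR
  -- A pair of a coloring and local choices with nonzero term fits at every face, hence is glued and
  -- comes from a configuration.
  refine Finset.sum_of_injOn (fun σ => (col σ, fun f => (σ.kind f, σ.variant f))) ?_ ?_ ?_ ?_
  · rintro ⟨k, v, _⟩ - ⟨k', v', _⟩ - h
    have h' := (Prod.ext_iff.1 h).2
    simp only [funext_iff, Prod.ext_iff] at h'
    obtain rfl : k = k' := funext fun f => (h' f).1
    obtain rfl : v = v' := funext fun f => (h' f).2
    rfl
  · intro _ _
    simp
  · rintro ⟨c, q⟩ - h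
    refine if_neg fun hq => h ?_
    have hq' : ∀ f j, c.1 (N.side f j) = decide (localColor (q f).1 (q f).2 j = .blue) :=
      fun f => (hq f (Finset.mem_univ f)).1
    let σ : LoopConfig N := ⟨fun f => (q f).1, fun f => (q f).2, fun f f' j j' hg => by
      apply decide_eq_blue_inj
      rw [← hq', ← hq', ← hg, c.2]⟩
    refine ⟨σ, by simp, Prod.ext ?_ rfl⟩
    refine EdgeFun.ext_side hR N fun f j => ?_
    rw [hcol σ, hq']
  · intro σ _
    have hiff : σ.Compatible s ↔ ∀ f ∈ Finset.univ, LocallyFits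
        (fun j => (col σ).1 (N.side f j)) (fun j => s.1 (N.side f j))
        (σ.kind f, σ.variant f) := by
      simp [LoopConfig.Compatible, LocallyFits, hcol]
    by_cases h : σ.Compatible s
    · rw [if_pos h, if_pos (hiff.1 h)]
    · rw [if_neg h, if_neg (mt hiff.2 h)]

theorem loopPartition_eq_sum [Finite V] (hR : R.IsQuadrangulation) (N : FaceNames R black)
    (W : R.Face → Kind → ℝ) :
    loopPartition N W = ∑ s : EdgeFun G, ∑ c : EdgeFun G, ∏ f : R.Face,
      localLoopSum (W f) (fun j => c.1 (N.side f j)) fun j => s.1 (N.side f j) := by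
  classical
  simp only [← sum_compatible hR]
  rw [Finset.sum_comm]
  refine Finset.sum_congr rfl fun σ _ => ?_
  rw [loopWeight, ← Finset.sum_filter, Finset.sum_const, nsmul_eq_mul]
  congr 1
  rw [← Fintype.card_subtype, ← Nat.card_eq_fintype_card, ← σ.two_pow_numLoops hR]
  simp

end LoopSum

/-! ### The dimer model as a sum over functions of the edges -/

/-- Exactly one of three booleans is true. -/
def exactlyOne : Bool → Bool → Bool → Bool
  | true, false, false => true
  | false, true, false => true
  | false, false, true => true
  | _, _, _ => false

/-- The weights of the four edges of a city. -/
def cityWeight (a b : ℝ) : Fin 4 → ℝ := ![a, b, a, b]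

/-- The sum of the weights of the sets of edges of a city that match the sides `j` for which
`s j` is false. -/
noncomputable def localDimerSum (a b : ℝ) (s : Fin 4 → Bool) : ℝ :=
  ∑ M : Fin 4 → Bool, if ∀ j, exactlyOne (s (j + 1)) (M j) (M (j + 1)) = true then
    ∏ j, (if M j = true then cityWeight a b j else 1) else 0

section DimerSum

variable {V : Type*} {G : SimpleGraph V} {R : RotationSystem G} {black : G.Coloring Bool}

theorem decoratedGraph_inc_inl {e : G.edgeSet} {d : G.Dart} :
    (decoratedGraph R).Inc (.inl e) d ↔ d.edge = e.1 :=
  ⟨fun ⟨_, h⟩ => h.1, fun h => ⟨d.symm, h, rfl⟩⟩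

theorem decoratedGraph_inc_inr {d d' : G.Dart} :
    (decoratedGraph R).Inc (.inr d') d ↔ d = d' ∨ d = R.facePerm d' := by
  constructor
  · rintro ⟨q, h | h⟩
    · exact .inl h.1
    · exact .inr h.2
  · rintro (h | h)
    · exact ⟨_, .inl ⟨h, rfl⟩⟩
    · exact ⟨_, .inr ⟨rfl, h⟩⟩

theorem RotationSystem.facePerm_ne (d : G.Dart) : R.facePerm d ≠ d := fun h => by
  have := R.facePerm_fst d
  rw [h] at this
  exact d.adj.ne this

/-- The edge below a dart. -/
def dartEdge (d : G.Dart) : G.edgeSet := ⟨d.edge, d.edge_mem⟩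

theorem dartEdge_surjective : Function.Surjective (dartEdge (G := G)) := by
  rintro ⟨e, he⟩
  induction e with
  | h x y => exact ⟨⟨(x, y), he⟩, rfl⟩

theorem existsUnique_mem_triple_iff {X : Type*} [DecidableEq X] (m : Finset X) {p q r : X}
    (h12 : p ≠ q) (h13 : p ≠ r) (h23 : q ≠ r) :
    (∃! e, e ∈ m ∧ (e = p ∨ e = q ∨ e = r)) ↔
      exactlyOne (decide (p ∈ m)) (decide (q ∈ m)) (decide (r ∈ m)) = true := by
  constructor
  · rintro ⟨e, ⟨he, h⟩, hu⟩
    have hp := fun h => hu p ⟨h, .inl rfl⟩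
    have hq := fun h => hu q ⟨h, .inr (.inl rfl)⟩
    have hr := fun h => hu r ⟨h, .inr (.inr rfl)⟩
    clear hu
    rcases h with rfl | rfl | rfl
    · have h2 : q ∉ m := fun h => h12 (hq h).symm
      have h3 : r ∉ m := fun h => h13 (hr h).symm
      simp [exactlyOne, he, h2, h3]
    · have h1 : p ∉ m := fun h => h12 (hp h)
      have h3 : r ∉ m := fun h => h23 (hr h).symm
      simp [exactlyOne, he, h1, h3]
    · have h1 : p ∉ m := fun h => h13 (hp h)
      have h2 : q ∉ m := fun h => h23 (hq h)
      simp [exactlyOne, he, h1, h2]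
  · intro h
    by_cases h1 : p ∈ m <;> by_cases h2 : q ∈ m <;> by_cases h3 : r ∈ m <;>
      simp only [h1, h2, h3, exactlyOne, decide_true, decide_false, Bool.false_eq_true] at h
    · exact ⟨p, by simp [h1], by rintro e ⟨he, rfl | rfl | rfl⟩ <;> simp_all⟩
    · exact ⟨q, by simp [h2], by rintro e ⟨he, rfl | rfl | rfl⟩ <;> simp_all⟩
    · exact ⟨r, by simp [h3], by rintro e ⟨he, rfl | rfl | rfl⟩ <;> simp_all⟩

/-- Three distinct edges meet at the side `facePerm d`: its road, and the city edges coming from the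
previous side and leading to the next one. The last two differ because `G` has no loop edges. -/
theorem existsUnique_mem_inc_iff [DecidableEq (G.edgeSet ⊕ G.Dart)]
    (m : Finset (G.edgeSet ⊕ G.Dart)) (d : G.Dart) :
    (∃! e, e ∈ m ∧ (decoratedGraph R).Inc e (R.facePerm d)) ↔
      exactlyOne (decide (.inl (dartEdge (R.facePerm d)) ∈ m)) (decide (.inr d ∈ m))
        (decide (.inr (R.facePerm d) ∈ m)) = true := by
  have hne := R.facePerm_ne d
  have hinc : ∀ e, (decoratedGraph R).Inc e (R.facePerm d) ↔
      e = .inl (dartEdge (R.facePerm d)) ∨ e = .inr d ∨ e = .inr (R.facePerm d) := by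
    rintro (e | d')
    · rw [decoratedGraph_inc_inl]
      simp [dartEdge, Subtype.ext_iff, eq_comm]
    · rw [decoratedGraph_inc_inr]
      simp only [reduceCtorEq, Sum.inr.injEq, false_or, EmbeddingLike.apply_eq_iff_eq]
      rw [or_comm, eq_comm (a := R.facePerm d), eq_comm (a := d)]
  have h12 : (.inl (dartEdge (R.facePerm d)) : G.edgeSet ⊕ G.Dart) ≠ .inr d := by simp
  have h13 : (.inl (dartEdge (R.facePerm d)) : G.edgeSet ⊕ G.Dart) ≠ .inr (R.facePerm d) := by
    simp
  have h23 : (.inr d : G.edgeSet ⊕ G.Dart) ≠ .inr (R.facePerm d) := by simpa using hne.symm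
  simp only [hinc]
  exact existsUnique_mem_triple_iff m h12 h13 h23

theorem isDimerConfig_iff [DecidableEq (G.edgeSet ⊕ G.Dart)]
    (m : Finset (G.edgeSet ⊕ G.Dart)) :
    IsDimerConfig (decoratedGraph R) m ↔ ∀ d,
      exactlyOne (decide (.inl (dartEdge (R.facePerm d)) ∈ m)) (decide (.inr d ∈ m))
        (decide (.inr (R.facePerm d) ∈ m)) = true := by
  simp only [← existsUnique_mem_inc_iff]
  rw [R.facePerm.forall_congr_right
    (q := fun v => ∃! e, e ∈ m ∧ (decoratedGraph R).Inc e v)]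
  constructor
  · intro h d
    exact h.2 d (Set.mem_univ d)
  · refine fun h => ⟨fun e _ => ?_, fun d _ => h d⟩
    obtain e | d := e
    · obtain ⟨d, rfl⟩ := dartEdge_surjective e
      exact (decoratedGraph_inc_inl (R := R).2 (rfl : d.edge = (dartEdge d).1)).edge_mem
    · exact (decoratedGraph_inc_inr (R := R).2 (.inl (rfl : d = d))).edge_mem

theorem decoratedWeight_side [Finite V] (N : FaceNames R black) (hR : R.IsQuadrangulation)
    (a b : R.Face → ℝ) (f : R.Face) (j : Fin 4) :
    decoratedWeight R black a b (.inr (N.side f j)) = cityWeight (a f) (b f) j := by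
  simp only [decoratedWeight, Coloring.black_snd, N.black_side_fst hR, N.faceOf_side]
  fin_cases j <;> simp [FaceNames.startsBlack, cityWeight]

theorem prod_decoratedWeight [Finite V] [DecidableEq (G.edgeSet ⊕ G.Dart)] (N : FaceNames R black)
    (hR : R.IsQuadrangulation) (a b : R.Face → ℝ) (m : Finset (G.edgeSet ⊕ G.Dart)) :
    ∏ e ∈ m, decoratedWeight R black a b e = ∏ f : R.Face, ∏ j,
      if decide (.inr (N.side f j) ∈ m) = true then cityWeight (a f) (b f) j else 1 := by
  have : Fintype G.edgeSet := Fintype.ofFinite _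
  have : Fintype G.Dart := Fintype.ofFinite _
  rw [← Fintype.prod_ite_mem, Fintype.prod_sum_type, ← (N.sideEquiv hR).prod_comp,
    Fintype.prod_prod_type]
  simp only [FaceNames.sideEquiv_apply, decoratedWeight_side N hR, decide_eq_true_eq]
  simp [decoratedWeight]

theorem dimerPartition_eq_sum [Finite V] (hR : R.IsQuadrangulation) (N : FaceNames R black)
    (a b : R.Face → ℝ) :
    dimerPartition (decoratedGraph R) (decoratedWeight R black a b) =
      ∑ s : EdgeFun G, ∏ f : R.Face,
        localDimerSum (a f) (b f) fun j => s.1 (N.side f j) := by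
  classical
  have : Fintype G.edgeSet := Fintype.ofFinite _
  have : Fintype G.Dart := Fintype.ofFinite _
  simp only [localDimerSum, Finset.prod_univ_sum, Fintype.piFinset_univ, Finset.prod_ite_zero]
  rw [← Fintype.sum_prod_type', dimerPartition]
  have hedge : ∀ d : G.Dart, dartEdge d.symm = dartEdge d := fun d =>
    Subtype.ext d.edge_symm
  -- A set of edges is encoded by its roads and by its city edges. The matching condition at a side
  -- involves only one city, so it splits as a product over faces.
  refine Finset.sum_of_injOn (fun m => (⟨fun d => decide (.inl (dartEdge d) ∈ m.1),
    fun d => by simp only [hedge]⟩, fun f j => decide (.inr (N.side f j) ∈ m.1))) ?_ ?_ ?_ ?_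
  · rintro m - m' - h
    simp only [Prod.ext_iff, Subtype.ext_iff, funext_iff, decide_eq_decide] at h
    ext e
    obtain e | d := e
    · obtain ⟨d, rfl⟩ := dartEdge_surjective e
      exact h.1 d
    · revert d
      rw [N.forall_side hR]
      exact h.2
  · intro _ _
    simp
  · rintro ⟨s, M⟩ - h
    refine if_neg fun hM => h ?_
    let e := N.sideEquiv hR
    let m : Finset (G.edgeSet ⊕ G.Dart) := Finset.univ.filter (Sum.elim
      (fun x => ∃ d, dartEdge d = x ∧ s.1 d = true)
      (fun d => M (e.symm d).1 (e.symm d).2 = true))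
    have hinl : ∀ d, (.inl (dartEdge d) ∈ m) ↔ s.1 d = true := by
      intro d
      simp only [m, Finset.mem_filter, Finset.mem_univ, true_and, Sum.elim_inl]
      constructor
      · rintro ⟨d', h, h'⟩
        rcases (SimpleGraph.dart_edge_eq_iff _ _).1 (Subtype.ext_iff.1 h) with rfl | rfl
        · exact h'
        · rwa [s.2] at h'
      · exact fun h => ⟨d, rfl, h⟩
    have hinr : ∀ f j, (.inr (N.side f j) ∈ m) ↔ M f j = true := by
      intro f j
      have : e.symm (N.side f j) = (f, j) := e.symm_apply_apply (f, j)
      simp only [m, Finset.mem_filter, Finset.mem_univ, true_and, Sum.elim_inr, this]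
    refine ⟨⟨m, ?_⟩, by simp, ?_⟩
    · rw [isDimerConfig_iff, N.forall_side hR]
      intro f j
      rw [N.facePerm_side hR]
      simp only [hinl, hinr, Bool.decide_eq_true]
      exact hM f (Finset.mem_univ f) j
    · simp only [hinl, hinr, Bool.decide_eq_true]
  · rintro ⟨m, hm⟩ -
    rw [isDimerConfig_iff, N.forall_side hR] at hm
    simp only [N.facePerm_side hR] at hm
    rw [if_pos fun f _ => hm f]
    exact prod_decoratedWeight N hR a b m

end DimerSum

/-! ### The local identity -/

theorem sum_fin_four_bool (F : (Fin 4 → Bool) → ℝ) :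
    ∑ M, F M = ∑ x : Bool, ∑ y : Bool, ∑ z : Bool, ∑ t : Bool, F ![x, y, z, t] := by
  let e : Bool × Bool × Bool × Bool ≃ (Fin 4 → Bool) :=
    { toFun := fun p => ![p.1, p.2.1, p.2.2.1, p.2.2.2]
      invFun := fun M => (M 0, M 1, M 2, M 3)
      left_inv := fun _ => rfl
      right_inv := fun M => by
        ext j
        fin_cases j <;> rfl }
  rw [← e.sum_comp]
  simp only [Fintype.sum_prod_type]
  rfl

/-- If all roads are occupied, the city is empty; if none is, its two perfect matchings contribute
`a ^ 2 + b ^ 2`, which the normalization makes equal to `1` as well. With two occupied roads at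
consecutive sides, one city edge covers the other two sides; every other case is impossible. -/
theorem localDimerSum_eq {a b : ℝ} (h : a ^ 2 + b ^ 2 = 1) (x y z t : Bool) :
    localDimerSum a b ![x, y, z, t] =
      if x = y ∧ z = t then (if y = z then 1 else a) else if y = z ∧ t = x then b else 0 := by
  simp only [localDimerSum, sum_fin_four_bool, Fintype.sum_bool, Fin.forall_fin_succ,
    Fin.prod_univ_four, cityWeight]
  cases x <;> cases y <;> cases z <;> cases t <;> simp [exactlyOne] <;> linear_combination h

theorem localLoopSum_eq (w : Kind → ℝ) (c₀ c₁ c₂ c₃ s₀ s₁ s₂ s₃ : Bool) :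
    localLoopSum w ![c₀, c₁, c₂, c₃] ![s₀, s₁, s₂, s₃] =
      (if c₀ = c₁ ∧ c₁ = c₂ ∧ c₂ = c₃ ∧ s₀ = s₁ ∧ s₂ = s₃ then w .one else 0) +
      (if c₀ = c₁ ∧ c₁ = c₂ ∧ c₂ = c₃ ∧ s₁ = s₂ ∧ s₃ = s₀ then w .two else 0) +
      (if c₀ = c₁ ∧ c₁ ≠ c₂ ∧ c₂ = c₃ ∧ s₀ = s₁ ∧ s₂ = s₃ then w .three else 0) +
      (if c₃ = c₀ ∧ c₀ ≠ c₁ ∧ c₁ = c₂ ∧ s₁ = s₂ ∧ s₃ = s₀ then w .four else 0) +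
      (if c₀ = c₂ ∧ c₁ = c₃ ∧ c₀ ≠ c₁ ∧ s₀ ≠ s₂ ∧ s₁ ≠ s₃ then w .five else 0) := by
  have huniv : (Finset.univ : Finset Kind) = {.one, .two, .three, .four, .five} := rfl
  have huniv' : (Finset.univ : Finset Variant) = {.a, .b} := rfl
  rw [localLoopSum, Fintype.sum_prod_type, huniv]
  simp only [huniv', LocallyFits, Fin.forall_fin_succ, localColor, Kind.joined, Kind.crosses]
  cases c₀ <;> cases c₁ <;> cases c₂ <;> cases c₃ <;> simp <;>
  cases s₀ <;> cases s₁ <;> cases s₂ <;> cases s₃ <;> simp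

/-- A check over the 256 values of `(c, s)`. When `c` and `s` are both constant, kinds one and two
both fit, and `a ^ 2 + b ^ 2 = 1` is needed. When `c` alternates, the two city factors are `a` and
`b` in some order whenever they are both nonzero, which gives kind five. -/
theorem localLoopSum_eq_mul {w : Kind → ℝ} {lam a b : ℝ} (h : Represents w lam a b)
    (c s : Fin 4 → Bool) :
    localLoopSum w c s =
      lam * (localDimerSum a b s * localDimerSum a b fun j => s j ^^ c j) := by
  obtain ⟨-, -, -, hab, h1, h2, h3, h4, h5⟩ := h
  have eta : ∀ g : Fin 4 → Bool, g = ![g 0, g 1, g 2, g 3] := fun g => by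
    ext j
    fin_cases j <;> rfl
  rw [eta c, eta s, eta fun j => _]
  simp only [localDimerSum_eq hab, localLoopSum_eq, h1, h2, h3, h4, h5]
  generalize c 0 = c₀, c 1 = c₁, c 2 = c₂, c 3 = c₃, s 0 = s₀, s 1 = s₁, s 2 = s₂, s 3 = s₃
  cases c₀ <;> cases c₁ <;> cases c₂ <;> cases c₃ <;>
  cases s₀ <;> cases s₁ <;> cases s₂ <;> cases s₃ <;> simp <;> grind

end C21Loops

open C21Loops
theorem theorem2p2 {V : Type*} [Finite V] (G : SimpleGraph V) (R : RotationSystem G)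
    (hR : R.IsQuadrangulation) (black : G.Coloring Bool) (N : FaceNames R black)
    (W : R.Face → Kind → ℝ) (hW : ∀ f i, 0 < W f i) (hff : ∀ f, FreeFermionic (W f)) :
    (∀ f, ∃! p : ℝ × ℝ × ℝ, Represents (W f) p.1 p.2.1 p.2.2) ∧
    ∀ lam a b : R.Face → ℝ, (∀ f, Represents (W f) (lam f) (a f) (b f)) →
      loopPartition N W =
        (∏ f : R.Face, lam f) *
          dimerPartition (decoratedGraph R) (decoratedWeight R black a b) ^ 2 := by
  refine ⟨fun f => existsUnique_represents (hW f) (hff f), fun lam a b hrep => ?_⟩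
  rw [loopPartition_eq_sum hR, dimerPartition_eq_sum hR N, sq, Finset.sum_mul, Finset.mul_sum]
  refine Finset.sum_congr rfl fun s _ => ?_
  -- For fixed `s`, the second dimer sum is reindexed by the coloring `c`, its set of roads being `s
  -- xor c`; the two sides then agree face by face.
  conv_rhs => rw [← (EdgeFun.xorEquiv s).sum_comp]
  rw [Finset.mul_sum, Finset.mul_sum]
  refine Finset.sum_congr rfl fun c _ => ?_
  rw [← Finset.prod_mul_distrib, ← Finset.prod_mul_distrib]
  exact Finset.prod_congr rfl fun f _ => localLoopSum_eq_mul (hrep f) _ _
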